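/- Let $r\ge 1$ be an integer. In inverse binomial sampling, independent Bernoulli trials with success probability $p\in(0,1)$ are observed until $r$ successes occur; the number of trials $N$ satisfies $\Pr[N=n]=f_p(n)=\binom{n-1}{r-1}p^r(1-p)^{n-r}$ for $n\ge r$. A (possibly randomized) estimator of $p$ is a family $(\Pi_n)_{n\ge r}$ of probability distributions on $(0,\infty)$, where $\Pi_n$ is the conditional law of $\hat p$ given $N=n$. For a loss function $L:(0,\infty)\to[0,\infty)$ its risk is $$\eta(p)=\sum_{n=r}^{\infty} f_p(n)\int_{(0,\infty)} L(y/p)\,\mathrm d\Pi_n(y)\in[0,\infty].$$ Assume that $L$ satisfies the following. (1) $L$ is of bounded variation on $[x_1,x_2]$ for all $0<x_1<x_2$. (2′) $L$ has finitely many discontinuities in $(0,\infty)$. (3′) There are real numbers $K<r$ and $K'<r$ such that $L(x)=\Theta(x^{K})$ as $x\to0^+$ and $L(x)=\Theta(x^{K'})$ as $x\to\infty$. (4) (a) There is $\xi>0$ such that $L$ is non-increasing on $(0,\xi]$ and $\int_\xi^\infty \frac{L(\xi)-L(x)}{x^{r+1}}\,\mathrm dx>0$. (b) There is $\xi'>0$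 such that $L$ is non-decreasing on $(\xi',\infty)$ and either (i) $\lim_{x\to\xi'^-}L(x)<\lim_{x\to\xi'^+}L(x)$, or (ii) for some integer $t\ge1$, $L$ is $C^t$ on an open interval containing $\xi'$, $L^{(i)}(\xi')=0$ for $1\le i\le t-1$, and $(-1)^{t-1}L^{(t)}(\xi')>0$. For $\Omega>0$ put $$\bar\eta(\Omega)=\int_0^\infty \frac{\nu^{r-1}e^{-\nu}}{(r-1)!}\,L(\Omega/\nu)\,\mathrm d\nu .$$ Then $\eta^*=\min_{\Omega>0}\bar\eta(\Omega)$ exists and is finite, and for every real $\eta_0<\eta^*$ and every $p_2>0$ there is no estimator whose risk satisfies $\eta(p)\le\eta_0$ for all $p\in(0,1)$ with $p<p_2$. -/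

import Mathlib

open MeasureTheory Filter Topology Asymptotics
open scoped ENNReal NNReal

noncomputable section

namespace InverseBinomial

/-- Probability that the number of trials needed to obtain `r` successes equals `n` (for `n ≥ r`),
when the success probability is `p`. -/
def trialsProb (r : ℕ) (p : ℝ) (n : ℕ) : ℝ :=
  ((n - 1).descFactorial (r - 1) : ℝ) / ((r - 1).factorial : ℝ) * p ^ r * (1 - p) ^ (n - r)

/-- A (possibly randomized) estimator based on inverse binomial sampling: to each value `n ≥ r` of
the number of trials it assigns the conditional law of the estimate, a probability distribution
on the positive reals. -/
abbrev Estimator (r : ℕ) : Type := Set.Ici r → ProbabilityMeasure (Set.Ioi (0 : ℝ))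

/-- The risk `E[L (p̂ / p)]` of an estimator, as an element of `[0, ∞]`. -/
def risk (r : ℕ) (L : ℝ → ℝ) (G : Estimator r) (p : ℝ) : ℝ≥0∞ :=
  ∑' n : Set.Ici r, ENNReal.ofReal (trialsProb r p n) *
    ∫⁻ y, ENNReal.ofReal (L ((y : ℝ) / p)) ∂(G n : Measure (Set.Ioi (0 : ℝ)))

/-- The Gamma density `φ(ν) = ν ^ (r - 1) exp (-ν) / (r - 1)!`. -/
def phi (r : ℕ) (ν : ℝ) : ℝ := ν ^ (r - 1) * Real.exp (-ν) / ((r - 1).factorial : ℝ)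

/-- The asymptotic risk `∫₀^∞ φ(ν) L(Ω / ν) dν` of the non-randomized estimators `g(N)` such that
`n g(n) → Ω`. -/
def asymptoticRisk (r : ℕ) (L : ℝ → ℝ) (Ω : ℝ) : ℝ≥0∞ :=
  ∫⁻ ν in Set.Ioi (0 : ℝ), ENNReal.ofReal (phi r ν * L (Ω / ν))

/-- Bounded variation on every compact interval of positive reals. -/
def LocallyBV (L : ℝ → ℝ) : Prop :=
  ∀ x₁ x₂ : ℝ, 0 < x₁ → x₁ < x₂ → BoundedVariationOn L (Set.Icc x₁ x₂)

/-- Finitely many discontinuities in the positive reals. -/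
def FinitelyManyDiscontinuities (L : ℝ → ℝ) : Prop :=
  {x : ℝ | 0 < x ∧ ¬ ContinuousAt L x}.Finite

/-- Exact power growth at `0` and at `∞`, with exponents less than `r`. -/
def PowerGrowth (r : ℕ) (L : ℝ → ℝ) : Prop :=
  (∃ K : ℝ, K < r ∧ L =Θ[𝓝[>] (0 : ℝ)] fun x => x ^ K) ∧
    ∃ K' : ℝ, K' < r ∧ L =Θ[atTop] fun x => x ^ K'

/-- `L` is non-increasing near `0`, up to a point `ξ` with the stated integral inequality. -/
def DecreasingNearZero (r : ℕ) (L : ℝ → ℝ) : Prop :=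
  ∃ ξ : ℝ, 0 < ξ ∧ AntitoneOn L (Set.Ioc 0 ξ) ∧
    0 < ∫ x in Set.Ioi ξ, (L ξ - L x) / x ^ (r + 1)

/-- `L` has an upward jump at `ξ`. -/
def UpwardJumpAt (L : ℝ → ℝ) (ξ : ℝ) : Prop :=
  ∃ l₁ l₂ : ℝ, Tendsto L (𝓝[<] ξ) (𝓝 l₁) ∧ Tendsto L (𝓝[>] ξ) (𝓝 l₂) ∧ l₁ < l₂

/-- For some `t ≥ 1`, `L` is `C^t` around `ξ`, its derivatives of orders `1, …, t - 1` vanish at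
`ξ`, and `(-1) ^ (t - 1)` times the `t`-th derivative is positive there. -/
def SmoothIncreaseAt (L : ℝ → ℝ) (ξ : ℝ) : Prop :=
  ∃ t : ℕ, 1 ≤ t ∧ (∃ a b : ℝ, a < ξ ∧ ξ < b ∧ ContDiffOn ℝ t L (Set.Ioo a b)) ∧
    (∀ i : ℕ, 1 ≤ i → i < t → iteratedDeriv i L ξ = 0) ∧
    0 < (-1 : ℝ) ^ (t - 1) * iteratedDeriv t L ξ

/-- `L` is non-decreasing beyond some point `ξ'`, at which it increases in one of two senses. -/
def IncreasingNearInfinity (L : ℝ → ℝ) : Prop :=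
  ∃ ξ' : ℝ, 0 < ξ' ∧ MonotoneOn L (Set.Ioi ξ') ∧ (UpwardJumpAt L ξ' ∨ SmoothIncreaseAt L ξ')

end InverseBinomial

end

/-! Write T(Ω) for the Gamma average `gammaAvg` of the loss. The lower bound on the risk comes from
averaging over p against the scale-invariant weight dp/p. In the term N = n, an estimate y and the
substitution p = ν/n turn the loss into L(ny/ν), and n times the probability of N = n tends to the
Gamma density times ν. That term therefore contributes about T(ny)/n ≥ η*/n, whatever y is. Over p ∈
[s/M, b] these contributions add up to about η* log M, while a risk bounded by η₀ integrates to at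
most η₀ log M + O(1); hence η₀ ≥ η*.

The comparison is uniform only for ν in a window [s, S], so what is needed is that the truncated
averages `truncAvg` are, for one wide window, above any c < η* simultaneously for all Ω. This is a
compactness statement in Ω ∈ [0, ∞] (`exists_gammaAvg_le_of_truncAvg_le`), obtained from Fatou's
lemma. At the ends Ω → 0 and Ω → ∞ the average tends to at least the limit of L at 0 or at ∞, and
condition (4) ensures that some finite positive Ω does no worse (`exists_gammaAvg_le_limit_zero`,
`exists_gammaAvg_le_limit_atTop`). The same compactness yields the minimum; `mul_le_of_risk_le` is
the averaging argument. -/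

namespace InverseBinomial

/-! ### Measurability of the loss and the Gamma averages -/

/-- The loss function on the positive reals, extended by `0`, with values in `[0, ∞]`. -/
noncomputable def lossExt (L : ℝ → ℝ) (x : ℝ) : ℝ≥0∞ := ENNReal.ofReal ((Set.Ioi 0).indicator L x)

lemma lossExt_of_pos (L : ℝ → ℝ) {x : ℝ} (hx : 0 < x) : lossExt L x = ENNReal.ofReal (L x) := by
  rw [lossExt, Set.indicator_of_mem (Set.mem_Ioi.2 hx)]

lemma measurable_lossExt {L : ℝ → ℝ} (h : FinitelyManyDiscontinuities L) :
    Measurable (lossExt L) := by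
  classical
  apply Measurable.ennreal_ofReal
  set D := {x : ℝ | 0 < x ∧ ¬ ContinuousAt L x} with hD
  have hm : MeasurableSet (Set.Ioi (0 : ℝ) \ D) := measurableSet_Ioi.diff h.measurableSet
  have hc : ContinuousOn L (Set.Ioi 0 \ D) := by
    intro x hx
    have : ContinuousAt L x := by
      by_contra hcon
      exact hx.2 ⟨hx.1, hcon⟩
    exact this.continuousWithinAt
  have h1 : Measurable ((Set.Ioi (0 : ℝ) \ D).indicator L) := by
    have := ContinuousOn.measurable_piecewise hc (continuousOn_const (c := (0 : ℝ))) hm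
    rwa [← Set.piecewise_eq_indicator]
  -- Restoring the values of `L` at its finitely many discontinuities does not affect measurability.
  refine h1.measurable_of_countable_ne (h.countable.mono ?_)
  intro x hx
  by_contra hxD
  apply hx
  by_cases hx0 : 0 < x
  · have hm1 : x ∈ Set.Ioi (0 : ℝ) \ D := ⟨hx0, hxD⟩
    rw [Set.indicator_of_mem hm1, Set.indicator_of_mem hm1.1]
  · have hm1 : x ∉ Set.Ioi (0 : ℝ) := hx0
    rw [Set.indicator_of_notMem (fun hh => hm1 hh.1), Set.indicator_of_notMem hm1]

lemma countable_discontinuities_lossExt {L : ℝ → ℝ} (h : FinitelyManyDiscontinuities L) :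
    {x : ℝ | 0 < x ∧ ¬ ContinuousAt (lossExt L) x}.Countable := by
  refine h.countable.mono ?_
  rintro x ⟨hx, hc⟩
  refine ⟨hx, fun hcL => hc ?_⟩
  have : lossExt L =ᶠ[𝓝 x] fun y => ENNReal.ofReal (L y) := by
    filter_upwards [Ioi_mem_nhds hx] with y hy using lossExt_of_pos L hy
  exact (ContinuousAt.congr_of_eventuallyEq
    (ENNReal.continuous_ofReal.continuousAt.comp hcL) this)

/-- The Gamma density with values in `[0, ∞]`. -/
noncomputable def gammaDens (r : ℕ) (ν : ℝ) : ℝ≥0∞ := ENNReal.ofReal (phi r ν)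

lemma phi_pos (r : ℕ) {ν : ℝ} (hν : 0 < ν) : 0 < phi r ν := by
  unfold phi; positivity

lemma continuous_phi (r : ℕ) : Continuous (phi r) := by
  unfold phi; fun_prop

lemma measurable_gammaDens (r : ℕ) : Measurable (gammaDens r) :=
  (continuous_phi r).measurable.ennreal_ofReal

/-- `∫₀^∞ φ(ν) f(Ω / ν) dν`. -/
noncomputable def gammaAvg (r : ℕ) (f : ℝ → ℝ≥0∞) (Ω : ℝ) : ℝ≥0∞ :=
  ∫⁻ ν in Set.Ioi 0, gammaDens r ν * f (Ω / ν)

/-- The part of `gammaAvg` that comes from `ν ∈ [s, S]`. -/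
noncomputable def truncAvg (r : ℕ) (f : ℝ → ℝ≥0∞) (s S Ω : ℝ) : ℝ≥0∞ :=
  ∫⁻ ν in Set.Icc s S, gammaDens r ν * f (Ω / ν)

lemma asymptoticRisk_eq_gammaAvg (r : ℕ) (L : ℝ → ℝ) {Ω : ℝ} (hΩ : 0 < Ω) :
    asymptoticRisk r L Ω = gammaAvg r (lossExt L) Ω := by
  refine setLIntegral_congr_fun measurableSet_Ioi fun ν hν => ?_
  have hν : 0 < ν := hν
  simp only [gammaDens]
  rw [lossExt_of_pos L (div_pos hΩ hν), ENNReal.ofReal_mul (phi_pos r hν).le]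

/-! ### Finiteness of the average under power growth -/

/-- After collecting powers of ν this is the Gamma integral with parameter r - K, which converges
because K < r. -/
lemma integrableOn_pow_mul_exp_mul_rpow {r : ℕ} (hr : 1 ≤ r) {K : ℝ} (hK : K < r) (C : ℝ) :
    IntegrableOn (fun ν : ℝ => phi r ν * (C * (1 / ν) ^ K)) (Set.Ioi 0) := by
  have h : IntegrableOn (fun x : ℝ => C / ((r - 1).factorial : ℝ) *
      (Real.exp (-x) * x ^ ((r : ℝ) - K - 1))) (Set.Ioi 0) :=
    (Real.GammaIntegral_convergent (s := r - K) (by linarith)).const_mul _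
  refine h.congr_fun (fun ν hν => ?_) measurableSet_Ioi
  have hν : 0 < ν := hν
  have e : ν ^ ((r : ℝ) - K - 1) = ν ^ (r - 1) * (1 / ν) ^ K := by
    rw [one_div, Real.inv_rpow hν.le, ← Real.rpow_neg hν.le, ← Real.rpow_natCast,
      ← Real.rpow_add hν]
    congr 1
    push_cast [Nat.cast_sub hr]
    ring
  simp only [phi]
  rw [e]
  ring

lemma lintegral_gammaDens {r : ℕ} (hr : 1 ≤ r) :
    ∫⁻ ν in Set.Ioi 0, gammaDens r ν = 1 := by
  have hi : IntegrableOn (phi r) (Set.Ioi 0) := by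
    have := integrableOn_pow_mul_exp_mul_rpow hr (K := 0) (by exact_mod_cast hr) 1
    simpa using this
  simp only [gammaDens]
  rw [← ofReal_integral_eq_lintegral_ofReal hi
    ((ae_restrict_mem measurableSet_Ioi).mono fun ν hν => (phi_pos r hν).le)]
  rw [ENNReal.ofReal_eq_one]
  have h1 := Real.Gamma_nat_eq_factorial (r - 1)
  rw [Real.Gamma_eq_integral (by positivity)] at h1
  have hf : ((r - 1).factorial : ℝ) ≠ 0 := by positivity
  have : ∀ ν : ℝ, phi r ν = ((r - 1).factorial : ℝ)⁻¹ *
      (Real.exp (-ν) * ν ^ (((r - 1 : ℕ) : ℝ) + 1 - 1)) := by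
    intro ν
    rw [add_sub_cancel_right, Real.rpow_natCast, phi]
    ring
  simp_rw [this]
  rw [integral_const_mul, h1, inv_mul_cancel₀ hf]

lemma exists_bound_of_boundedVariationOn {L : ℝ → ℝ} {a b : ℝ}
    (h : BoundedVariationOn L (Set.Icc a b)) : ∃ B : ℝ, 0 ≤ B ∧ ∀ x ∈ Set.Icc a b, L x ≤ B := by
  rcases le_or_gt a b with hab | hab
  · refine ⟨|L a| + (eVariationOn L (Set.Icc a b)).toReal, by positivity, fun x hx => ?_⟩
    have := h.dist_le hx (Set.left_mem_Icc.2 hab)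
    rw [Real.dist_eq] at this
    have h1 := le_abs_self (L x - L a)
    have h2 := le_abs_self (L a)
    linarith
  · exact ⟨0, le_rfl, fun x hx => absurd (hx.1.trans hx.2) (not_le.2 hab)⟩

lemma exists_power_bound {r : ℕ} {L : ℝ → ℝ} (h1 : LocallyBV L) (h3 : PowerGrowth r L) :
    ∃ K K' C C' B : ℝ, K < r ∧ K' < r ∧
      ∀ x : ℝ, 0 < x → L x ≤ C * x ^ K + C' * x ^ K' + B := by
  obtain ⟨⟨K, hK, hΘ⟩, K', hK', hΘ'⟩ := h3
  obtain ⟨C, hC, hb⟩ := hΘ.1.exists_pos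
  obtain ⟨C', hC', hb'⟩ := hΘ'.1.exists_pos
  rw [isBigOWith_iff] at hb hb'
  obtain ⟨ε, hε, hεb⟩ := mem_nhdsGT_iff_exists_Ioo_subset.1 hb
  obtain ⟨R, hR⟩ := eventually_atTop.1 hb'
  have hε : 0 < ε := hε
  set R' := max R (ε + 1)
  obtain ⟨B, hB0, hB⟩ := exists_bound_of_boundedVariationOn
    (h1 ε R' hε (lt_of_lt_of_le (lt_add_one ε) (le_max_right _ _)))
  refine ⟨K, K', C, C', B, hK, hK', fun x hx => ?_⟩
  have p1 : 0 ≤ C * x ^ K := by positivity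
  have p2 : 0 ≤ C' * x ^ K' := by positivity
  rcases lt_or_ge x ε with hxε | hxε
  · have h : ‖L x‖ ≤ C * ‖x ^ K‖ := hεb ⟨hx, hxε⟩
    rw [Real.norm_eq_abs, Real.norm_of_nonneg (by positivity : 0 ≤ x ^ K)] at h
    linarith [le_abs_self (L x)]
  rcases le_or_gt x R' with hxR | hxR
  · linarith [hB x ⟨hxε, hxR⟩]
  · have h : ‖L x‖ ≤ C' * ‖x ^ K'‖ := hR x ((le_max_left _ _).trans hxR.le)
    rw [Real.norm_eq_abs, Real.norm_of_nonneg (by positivity : 0 ≤ x ^ K')] at h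
    linarith [le_abs_self (L x)]

lemma gammaAvg_one_lt_top {r : ℕ} (hr : 1 ≤ r) {L : ℝ → ℝ} (h1 : LocallyBV L)
    (h3 : PowerGrowth r L) : gammaAvg r (lossExt L) 1 < ⊤ := by
  obtain ⟨K, K', C, C', B, hK, hK', hb⟩ := exists_power_bound h1 h3
  have hB := integrableOn_pow_mul_exp_mul_rpow hr (K := 0) (by exact_mod_cast hr) B
  have hi := ((integrableOn_pow_mul_exp_mul_rpow hr hK C).add
    (integrableOn_pow_mul_exp_mul_rpow hr hK' C')).add hB
  refine lt_of_le_of_lt ?_ (Integrable.lintegral_lt_top hi)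
  refine setLIntegral_mono_ae' measurableSet_Ioi (ae_of_all _ fun ν hν => ?_)
  have hν : 0 < ν := hν
  rw [lossExt_of_pos L (by positivity), gammaDens, ← ENNReal.ofReal_mul (phi_pos r hν).le]
  apply ENNReal.ofReal_le_ofReal
  simp only [Pi.add_apply]
  rw [← mul_add, ← mul_add]
  refine mul_le_mul_of_nonneg_left ?_ (phi_pos r hν).le
  have := hb (1 / ν) (by positivity)
  simpa using this

/-! ### The average in the variable x = Ω/ν -/

/-- The density of `Ω / ν` when `ν` has the Gamma distribution. -/
noncomputable def invGammaDens (r : ℕ) (Ω x : ℝ) : ℝ :=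
  Ω ^ r * Real.exp (-(Ω / x)) / (x ^ (r + 1) * ((r - 1).factorial : ℝ))

lemma invGammaDens_pos (r : ℕ) {Ω x : ℝ} (hΩ : 0 < Ω) (hx : 0 < x) : 0 < invGammaDens r Ω x := by
  unfold invGammaDens; positivity

lemma measurable_invGammaDens (r : ℕ) (Ω : ℝ) : Measurable (invGammaDens r Ω) := by
  unfold invGammaDens; fun_prop

lemma gammaAvg_eq_lintegral_invGammaDens {r : ℕ} (hr : 1 ≤ r) (f : ℝ → ℝ≥0∞) {Ω : ℝ} (hΩ : 0 < Ω) :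
    gammaAvg r f Ω = ∫⁻ x in Set.Ioi 0, ENNReal.ofReal (invGammaDens r Ω x) * f x := by
  have himg : (fun x : ℝ => Ω / x) '' Set.Ioi 0 = Set.Ioi 0 := by
    ext ν
    constructor
    · rintro ⟨x, hx, rfl⟩
      exact div_pos hΩ hx
    · intro hν
      have hν : 0 < ν := hν
      exact ⟨Ω / ν, div_pos hΩ hν, by field_simp⟩
  have hinj : Set.InjOn (fun x : ℝ => Ω / x) (Set.Ioi 0) := by
    intro x hx y hy hxy
    have hx : 0 < x := hx
    have hy : 0 < y := hy
    simp only at hxy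
    field_simp at hxy
    exact hxy.symm
  have hder : ∀ x ∈ Set.Ioi (0 : ℝ),
      HasDerivWithinAt (fun x : ℝ => Ω / x) (-(Ω / x ^ 2)) (Set.Ioi 0) x := by
    intro x hx
    have hx : 0 < x := hx
    have := ((hasDerivAt_inv hx.ne').const_mul Ω).hasDerivWithinAt (s := Set.Ioi 0)
    simpa [div_eq_mul_inv] using this
  have key := lintegral_image_eq_lintegral_abs_deriv_mul measurableSet_Ioi hder hinj
    (fun ν => gammaDens r ν * f (Ω / ν))
  rw [himg] at key
  rw [gammaAvg, key]
  refine setLIntegral_congr_fun measurableSet_Ioi fun x hx => ?_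
  have hx : 0 < x := hx
  have e : Ω / (Ω / x) = x := by field_simp
  simp only [e, gammaDens]
  rw [← mul_assoc, ← ENNReal.ofReal_mul (abs_nonneg _)]
  congr 2
  rw [abs_neg, abs_of_pos (by positivity), phi, invGammaDens]
  obtain ⟨k, rfl⟩ : ∃ k, r = k + 1 := ⟨r - 1, by omega⟩
  simp only [Nat.add_sub_cancel]
  field_simp
  rw [div_pow]
  field_simp
  ring

lemma lintegral_invGammaDens {r : ℕ} (hr : 1 ≤ r) {Ω : ℝ} (hΩ : 0 < Ω) :
    ∫⁻ x in Set.Ioi 0, ENNReal.ofReal (invGammaDens r Ω x) = 1 := by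
  have h := gammaAvg_eq_lintegral_invGammaDens hr (fun _ => 1) hΩ
  simp only [mul_one, gammaAvg] at h
  rw [← h, lintegral_gammaDens hr]

/-! ### Some Gamma average is at most the limit of the loss at 0, and likewise at ∞ -/

lemma tendsto_nhdsGT_zero_of_antitoneOn {f : ℝ → ℝ≥0∞} {ξ : ℝ} (hξ : 0 < ξ)
    (hf : AntitoneOn f (Set.Ioc 0 ξ)) :
    Tendsto f (𝓝[>] 0) (𝓝 (sSup (f '' Set.Ioc 0 ξ))) := by
  rw [tendsto_order]
  constructor
  · intro a ha
    obtain ⟨_, ⟨x, hx, rfl⟩, hax⟩ := lt_sSup_iff.1 ha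
    filter_upwards [Ioo_mem_nhdsGT hx.1] with y hy
    exact hax.trans_le (hf ⟨hy.1, hy.2.le.trans hx.2⟩ hx hy.2.le)
  · intro a ha
    filter_upwards [Ioo_mem_nhdsGT hξ] with y hy
    exact (le_sSup (Set.mem_image_of_mem f (Set.Ioo_subset_Ioc_self hy))).trans_lt ha

lemma tendsto_atTop_of_monotoneOn_Ioi {f : ℝ → ℝ≥0∞} {ξ : ℝ} (hf : MonotoneOn f (Set.Ioi ξ)) :
    Tendsto f atTop (𝓝 (sSup (f '' Set.Ioi ξ))) := by
  rw [tendsto_order]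
  constructor
  · intro a ha
    obtain ⟨_, ⟨x, hx, rfl⟩, hax⟩ := lt_sSup_iff.1 ha
    filter_upwards [eventually_ge_atTop x] with y hy
    exact hax.trans_le (hf hx (Set.mem_Ioi.2 (lt_of_lt_of_le hx hy)) hy)
  · intro a ha
    filter_upwards [eventually_gt_atTop ξ] with y hy
    exact (le_sSup (Set.mem_image_of_mem f hy)).trans_lt ha

/-- By dominated convergence the integral with the factor exp(-Ω/x) tends to the one without it as Ω
→ 0, so positivity survives for small Ω. -/
lemma exists_integral_mul_exp_pos {h : ℝ → ℝ} {ξ : ℝ} (hξ : 0 < ξ)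
    (hpos : 0 < ∫ x in Set.Ioi ξ, h x) :
    ∃ Ω : ℝ, 0 < Ω ∧ 0 < ∫ x in Set.Ioi ξ, h x * Real.exp (-(Ω / x)) := by
  -- The integral of a non-integrable function is 0 by convention, so positivity forces
  -- integrability.
  have hint : IntegrableOn h (Set.Ioi ξ) := by
    by_contra hcon
    rw [integral_undef hcon] at hpos
    exact lt_irrefl _ hpos
  have hlim : Tendsto (fun Ω : ℝ => ∫ x in Set.Ioi ξ, h x * Real.exp (-(Ω / x))) (𝓝[>] 0)
      (𝓝 (∫ x in Set.Ioi ξ, h x)) := by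
    refine tendsto_integral_filter_of_dominated_convergence (fun x => ‖h x‖) ?_ ?_ hint.norm ?_
    · refine Eventually.of_forall fun Ω => hint.aestronglyMeasurable.mul ?_
      exact Measurable.aestronglyMeasurable (by fun_prop)
    · filter_upwards [self_mem_nhdsWithin] with Ω hΩ
      filter_upwards [ae_restrict_mem measurableSet_Ioi] with x hx
      have hx : 0 < x := hξ.trans hx
      have hΩ : 0 < Ω := hΩ
      rw [norm_mul, Real.norm_of_nonneg (Real.exp_pos _).le]
      refine mul_le_of_le_one_right (norm_nonneg _) (Real.exp_le_one_iff.2 ?_)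
      have : 0 < Ω / x := by positivity
      linarith
    · refine ae_of_all _ fun x => ?_
      have : Tendsto (fun Ω : ℝ => h x * Real.exp (-(Ω / x))) (𝓝 0)
          (𝓝 (h x * Real.exp (-(0 / x)))) := by
        apply Continuous.tendsto
        fun_prop
      simp only [zero_div, neg_zero, Real.exp_zero, mul_one] at this
      exact this.mono_left nhdsWithin_le_nhds
  obtain ⟨Ω, h1, h2⟩ := ((hlim.eventually_const_lt hpos).and self_mem_nhdsWithin).exists
  exact ⟨Ω, h2, h1⟩

/-- For small Ω the density of Ω/ν is a constant times exp(-Ω/x)/x^(r+1), nearly the weight of the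
hypothesis. So beyond ξ the loss averages to at most L(ξ) ≤ A, on (0, ξ] it is at most A pointwise,
and the total mass is 1. -/
lemma exists_gammaAvg_le_of_integral_pos {r : ℕ} (hr : 1 ≤ r) {L : ℝ → ℝ}
    (hL : ∀ x : ℝ, 0 < x → 0 ≤ L x) {ξ : ℝ} (hξ : 0 < ξ)
    (hpos : 0 < ∫ x in Set.Ioi ξ, (L ξ - L x) / x ^ (r + 1)) {A : ℝ≥0∞}
    (hA : ∀ x ∈ Set.Ioc 0 ξ, lossExt L x ≤ A) :
    ∃ Ω : ℝ, 0 < Ω ∧ gammaAvg r (lossExt L) Ω ≤ A := by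
  obtain ⟨Ω, hΩ, hi⟩ := exists_integral_mul_exp_pos hξ hpos
  refine ⟨Ω, hΩ, ?_⟩
  set w : ℝ → ℝ := invGammaDens r Ω with hw
  have hwpos : ∀ x, 0 < x → 0 < w x := fun x hx => invGammaDens_pos r hΩ hx
  have hwm : Measurable w := measurable_invGammaDens r Ω
  have hsub : Set.Ioi ξ ⊆ Set.Ioi 0 := Set.Ioi_subset_Ioi hξ.le
  have hwi0 : IntegrableOn w (Set.Ioi 0) := by
    refine ⟨hwm.aestronglyMeasurable, ?_⟩
    rw [hasFiniteIntegral_iff_ofReal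
      ((ae_restrict_mem measurableSet_Ioi).mono fun x hx => (hwpos x hx).le),
      lintegral_invGammaDens hr hΩ]
    exact ENNReal.one_lt_top
  have hwi : IntegrableOn w (Set.Ioi ξ) := hwi0.mono_set hsub
  have hge : 0 < ∫ x in Set.Ioi ξ, w x * (L ξ - L x) := by
    have : ∀ x, w x * (L ξ - L x) = Ω ^ r / ((r - 1).factorial : ℝ) *
        ((L ξ - L x) / x ^ (r + 1) * Real.exp (-(Ω / x))) := by
      intro x
      rw [hw, invGammaDens, mul_comm (x ^ (r + 1)) _, ← div_div]
      ring
    simp_rw [this]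
    rw [integral_const_mul]
    positivity
  have hdi : IntegrableOn (fun x => w x * (L ξ - L x)) (Set.Ioi ξ) := by
    by_contra hcon
    rw [integral_undef hcon] at hge
    exact lt_irrefl _ hge
  have hci : IntegrableOn (fun x => w x * L ξ) (Set.Ioi ξ) := hwi.mul_const _
  have hLi : IntegrableOn (fun x => w x * L x) (Set.Ioi ξ) := by
    refine (hci.sub hdi).congr_fun (fun x _ => ?_) measurableSet_Ioi
    simp only [Pi.sub_apply]
    ring
  have hle : ∫ x in Set.Ioi ξ, w x * L x ≤ ∫ x in Set.Ioi ξ, w x * L ξ := by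
    have : ∫ x in Set.Ioi ξ, w x * (L ξ - L x) =
        (∫ x in Set.Ioi ξ, w x * L ξ) - ∫ x in Set.Ioi ξ, w x * L x := by
      rw [← integral_sub hci hLi]
      simp_rw [mul_sub]
    linarith
  have hLξ := hL ξ hξ
  have hae : ∀ᵐ x ∂volume.restrict (Set.Ioi ξ), 0 < x :=
    (ae_restrict_mem measurableSet_Ioi).mono fun x hx => hsub hx
  have hright : ∫⁻ x in Set.Ioi ξ, ENNReal.ofReal (w x) * lossExt L x ≤
      ∫⁻ x in Set.Ioi ξ, ENNReal.ofReal (w x) * A := by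
    calc ∫⁻ x in Set.Ioi ξ, ENNReal.ofReal (w x) * lossExt L x
        = ∫⁻ x in Set.Ioi ξ, ENNReal.ofReal (w x * L x) := by
          refine lintegral_congr_ae (hae.mono fun x hx => ?_)
          simp only
          rw [lossExt_of_pos L hx, ENNReal.ofReal_mul (hwpos x hx).le]
      _ = ENNReal.ofReal (∫ x in Set.Ioi ξ, w x * L x) :=
          (ofReal_integral_eq_lintegral_ofReal hLi
            (hae.mono fun x hx => mul_nonneg (hwpos x hx).le (hL x hx))).symm
      _ ≤ ENNReal.ofReal (∫ x in Set.Ioi ξ, w x * L ξ) := ENNReal.ofReal_le_ofReal hle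
      _ = ∫⁻ x in Set.Ioi ξ, ENNReal.ofReal (w x * L ξ) :=
          ofReal_integral_eq_lintegral_ofReal hci
            (hae.mono fun x hx => mul_nonneg (hwpos x hx).le hLξ)
      _ ≤ ∫⁻ x in Set.Ioi ξ, ENNReal.ofReal (w x) * A := by
          refine lintegral_mono_ae (hae.mono fun x hx => ?_)
          rw [ENNReal.ofReal_mul (hwpos x hx).le]
          gcongr
          rw [← lossExt_of_pos L hξ]
          exact hA ξ ⟨hξ, le_rfl⟩
  have hleft : ∫⁻ x in Set.Ioc 0 ξ, ENNReal.ofReal (w x) * lossExt L x ≤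
      ∫⁻ x in Set.Ioc 0 ξ, ENNReal.ofReal (w x) * A := by
    refine setLIntegral_mono_ae' measurableSet_Ioc (ae_of_all _ fun x hx => ?_)
    gcongr
    exact hA x hx
  have hsplit : ∀ g : ℝ → ℝ≥0∞, ∫⁻ x in Set.Ioi 0, g x =
      (∫⁻ x in Set.Ioc 0 ξ, g x) + ∫⁻ x in Set.Ioi ξ, g x := by
    intro g
    rw [← Set.Ioc_union_Ioi_eq_Ioi hξ.le, lintegral_union measurableSet_Ioi]
    exact Set.Ioc_disjoint_Ioi le_rfl
  rw [gammaAvg_eq_lintegral_invGammaDens hr _ hΩ, hsplit]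
  refine (add_le_add hleft hright).trans ?_
  rw [← hsplit, lintegral_mul_const _ hwm.ennreal_ofReal, lintegral_invGammaDens hr hΩ, one_mul]

/-- If `f ≤ A` almost everywhere beyond `α`, with a strict gain on `(α, β)`, then the mass of
`f` on `(0, α]` is exponentially negligible against that gain. -/
lemma exists_gammaAvg_le_of_gap {r : ℕ} (hr : 1 ≤ r) {f : ℝ → ℝ≥0∞}
    (hfin : gammaAvg r f 1 < ⊤) {α β : ℝ} (hα : 0 < α) (hαβ : α < β) {A A' : ℝ} (hA'0 : 0 ≤ A')
    (hA'A : A' < A) (hmid : ∀ x ∈ Set.Ioo α β, f x ≤ ENNReal.ofReal A')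
    (hbig : ∀ᵐ x, α < x → f x ≤ ENNReal.ofReal A) :
    ∃ Ω : ℝ, 0 < Ω ∧ gammaAvg r f Ω ≤ ENNReal.ofReal A := by
  have hβ : 0 < β := hα.trans hαβ
  set m := (α + β) / 2 with hm
  have hαm : α < m := by rw [hm]; linarith
  have hmβ : m < β := by rw [hm]; linarith
  have hm0 : 0 < m := hα.trans hαm
  set M := (gammaAvg r f 1).toReal with hM
  set κ : ℝ := (β ^ (r + 1) * ((r - 1).factorial : ℝ))⁻¹ with hκ
  have hκ0 : 0 < κ := by positivity
  -- Up to the common factor Ω^r, the left side bounds the contribution of (0, α], by comparison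
  -- with the density at Ω = 1. The right side is the gain A - A' times a lower bound for the mass
  -- of (m, β). Since α < m, the ratio exp(Ω(1/α - 1/m)) is unbounded.
  obtain ⟨Ω, hΩ1, hΩ⟩ : ∃ Ω : ℝ, 1 ≤ Ω ∧
      Real.exp (-((Ω - 1) / α)) * M ≤ (A - A') * (Real.exp (-(Ω / m)) * κ * (β - m)) := by
    have hd : 0 < 1 / α - 1 / m := sub_pos.2 (one_div_lt_one_div_of_lt hα hαm)
    have ht : Tendsto (fun Ω : ℝ => Real.exp (Ω * (1 / α - 1 / m))) atTop atTop :=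
      Real.tendsto_exp_atTop.comp (tendsto_id.atTop_mul_const hd)
    have hc : 0 < (A - A') * (κ * (β - m)) :=
      mul_pos (sub_pos.2 hA'A) (mul_pos hκ0 (sub_pos.2 hmβ))
    obtain ⟨Ω, h1, h2⟩ := ((ht.eventually_ge_atTop
      (Real.exp (1 / α) * M / ((A - A') * (κ * (β - m))))).and (eventually_ge_atTop 1)).exists
    refine ⟨Ω, h2, ?_⟩
    rw [div_le_iff₀ hc] at h1
    have e1 : Real.exp (-((Ω - 1) / α)) = Real.exp (-(Ω / α)) * Real.exp (1 / α) := by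
      rw [← Real.exp_add]; congr 1; ring
    have e2 : Real.exp (-(Ω / m)) = Real.exp (-(Ω / α)) * Real.exp (Ω * (1 / α - 1 / m)) := by
      rw [← Real.exp_add]; congr 1; ring
    rw [e1, e2]
    have := mul_le_mul_of_nonneg_left h1 (Real.exp_pos (-(Ω / α))).le
    linarith
  have hΩ0 : 0 < Ω := by linarith
  refine ⟨Ω, hΩ0, ?_⟩
  set w : ℝ → ℝ := invGammaDens r Ω with hw
  have hwm : Measurable fun x => ENNReal.ofReal (w x) :=
    (measurable_invGammaDens r Ω).ennreal_ofReal
  have hsplit : ∀ g : ℝ → ℝ≥0∞, ∫⁻ x in Set.Ioi 0, g x =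
      (∫⁻ x in Set.Ioc 0 α, g x) + ((∫⁻ x in Set.Ioo α β, g x) + ∫⁻ x in Set.Ici β, g x) := by
    intro g
    rw [← Set.Ioc_union_Ioi_eq_Ioi hα.le, lintegral_union measurableSet_Ioi
      (Set.Ioc_disjoint_Ioi le_rfl), ← Set.Ioo_union_Ici_eq_Ioi hαβ,
      lintegral_union measurableSet_Ici]
    exact Set.disjoint_left.2 fun x hx hx' => absurd hx.2 (not_lt.2 hx')
  have hlow : ∫⁻ x in Set.Ioc 0 α, ENNReal.ofReal (w x) * f x ≤
      ENNReal.ofReal (Ω ^ r * Real.exp (-((Ω - 1) / α)) * M) := by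
    calc ∫⁻ x in Set.Ioc 0 α, ENNReal.ofReal (w x) * f x
        ≤ ∫⁻ x in Set.Ioc 0 α, ENNReal.ofReal (Ω ^ r * Real.exp (-((Ω - 1) / α))) *
            (ENNReal.ofReal (invGammaDens r 1 x) * f x) := by
          refine setLIntegral_mono_ae' measurableSet_Ioc (ae_of_all _ fun x hx => ?_)
          rw [← mul_assoc, ← ENNReal.ofReal_mul (by positivity)]
          gcongr
          have hx0 : 0 < x := hx.1
          rw [hw, invGammaDens, invGammaDens, one_pow, one_mul, ← mul_div_assoc]
          refine div_le_div_of_nonneg_right ?_ (by positivity)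
          rw [mul_assoc, ← Real.exp_add]
          gcongr
          have : (Ω - 1) / α ≤ (Ω - 1) / x :=
            div_le_div_of_nonneg_left (by linarith) hx0 hx.2
          have e : Ω / x = (Ω - 1) / x + 1 / x := by ring
          linarith
      _ = ENNReal.ofReal (Ω ^ r * Real.exp (-((Ω - 1) / α))) *
            ∫⁻ x in Set.Ioc 0 α, ENNReal.ofReal (invGammaDens r 1 x) * f x :=
          lintegral_const_mul' _ _ ENNReal.ofReal_ne_top
      _ ≤ ENNReal.ofReal (Ω ^ r * Real.exp (-((Ω - 1) / α))) * gammaAvg r f 1 := by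
          rw [gammaAvg_eq_lintegral_invGammaDens hr f one_pos]
          gcongr
          exact Set.Ioc_subset_Ioi_self
      _ = _ := by
          rw [ENNReal.ofReal_mul (p := Ω ^ r * Real.exp (-((Ω - 1) / α))) (by positivity), hM,
            ENNReal.ofReal_toReal hfin.ne]
  have hmass : ENNReal.ofReal (Ω ^ r * (Real.exp (-(Ω / m)) * κ * (β - m))) ≤
      ∫⁻ x in Set.Ioo α β, ENNReal.ofReal (w x) := by
    calc ENNReal.ofReal (Ω ^ r * (Real.exp (-(Ω / m)) * κ * (β - m)))
        = ∫⁻ x in Set.Ioo m β, ENNReal.ofReal (Ω ^ r * Real.exp (-(Ω / m)) * κ) := by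
          rw [setLIntegral_const, Real.volume_Ioo, ← ENNReal.ofReal_mul (by positivity)]
          congr 1
          ring
      _ ≤ ∫⁻ x in Set.Ioo m β, ENNReal.ofReal (w x) := by
          refine setLIntegral_mono_ae' measurableSet_Ioo (ae_of_all _ fun x hx => ?_)
          apply ENNReal.ofReal_le_ofReal
          have hx0 : 0 < x := hm0.trans hx.1
          rw [hw, invGammaDens, hκ, ← div_eq_mul_inv]
          have h1 := hx.1.le
          have h2 := hx.2.le
          gcongr
      _ ≤ _ := lintegral_mono_set (Set.Ioo_subset_Ioo_left hαm.le)
  have hmidI : ∫⁻ x in Set.Ioo α β, ENNReal.ofReal (w x) * f x ≤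
      (∫⁻ x in Set.Ioo α β, ENNReal.ofReal (w x)) * ENNReal.ofReal A' := by
    rw [← lintegral_mul_const _ hwm]
    refine setLIntegral_mono_ae' measurableSet_Ioo (ae_of_all _ fun x hx => ?_)
    gcongr
    exact hmid x hx
  have hbigI : ∫⁻ x in Set.Ici β, ENNReal.ofReal (w x) * f x ≤
      (∫⁻ x in Set.Ici β, ENNReal.ofReal (w x)) * ENNReal.ofReal A := by
    rw [← lintegral_mul_const _ hwm]
    refine setLIntegral_mono_ae' measurableSet_Ici (hbig.mono fun x hx hxβ => ?_)
    gcongr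
    exact hx (hαβ.trans_le hxβ)
  have hlow' : ∫⁻ x in Set.Ioc 0 α, ENNReal.ofReal (w x) * f x ≤
      (∫⁻ x in Set.Ioo α β, ENNReal.ofReal (w x)) * ENNReal.ofReal (A - A') := by
    refine hlow.trans (le_trans ?_ (mul_le_mul_left hmass _))
    rw [← ENNReal.ofReal_mul (by
      have := sub_pos.2 hmβ
      positivity)]
    apply ENNReal.ofReal_le_ofReal
    have := mul_le_mul_of_nonneg_left hΩ (by positivity : 0 ≤ Ω ^ r)
    linarith
  have hsum : (∫⁻ x in Set.Ioo α β, ENNReal.ofReal (w x)) +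
      ∫⁻ x in Set.Ici β, ENNReal.ofReal (w x) ≤ 1 := by
    rw [← lintegral_invGammaDens hr hΩ0, hsplit]
    exact le_add_self
  rw [gammaAvg_eq_lintegral_invGammaDens hr f hΩ0, hsplit]
  calc _ ≤ (∫⁻ x in Set.Ioo α β, ENNReal.ofReal (w x)) * ENNReal.ofReal (A - A') +
        ((∫⁻ x in Set.Ioo α β, ENNReal.ofReal (w x)) * ENNReal.ofReal A' +
          (∫⁻ x in Set.Ici β, ENNReal.ofReal (w x)) * ENNReal.ofReal A) :=
        add_le_add hlow' (add_le_add hmidI hbigI)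
    _ = ((∫⁻ x in Set.Ioo α β, ENNReal.ofReal (w x)) +
          ∫⁻ x in Set.Ici β, ENNReal.ofReal (w x)) * ENNReal.ofReal A := by
        rw [← add_assoc, ← mul_add, ← ENNReal.ofReal_add (sub_pos.2 hA'A).le hA'0,
          sub_add_cancel, add_mul]
    _ ≤ 1 * ENNReal.ofReal A := mul_le_mul_left hsum _
    _ = _ := one_mul _

/-- In Taylor's formula at ξ the leading term is D (x - ξ)^t / t! with D the t-th derivative. The
sign condition on D makes it negative for x < ξ, whatever the parity of t. -/
lemma SmoothIncreaseAt.eventually_lt {L : ℝ → ℝ} {ξ : ℝ} (h : SmoothIncreaseAt L ξ) :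
    ∀ᶠ x in 𝓝[<] ξ, L x < L ξ := by
  obtain ⟨t, ht, ⟨a, b, ha, hb, hc⟩, hz, hpos⟩ := h
  have hmem : ξ ∈ Set.Ioo a b := ⟨ha, hb⟩
  have hT := taylor_isLittleO (convex_Ioo a b) hmem hc
  rw [nhdsWithin_eq_nhds.2 (Ioo_mem_nhds ha hb)] at hT
  set D := iteratedDeriv t L ξ with hD
  have hD0 : 0 < |D| := abs_pos.2 fun h0 => by simp [h0] at hpos
  have hev : ∀ x, taylorWithinEval L t (Set.Ioo a b) ξ x =
      L ξ + D / (t.factorial : ℝ) * (x - ξ) ^ t := by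
    intro x
    have hd : ∀ k, iteratedDerivWithin k L (Set.Ioo a b) ξ = iteratedDeriv k L ξ :=
      fun k => iteratedDerivWithin_of_isOpen isOpen_Ioo hmem
    rw [taylor_within_apply, Finset.sum_range_succ, Finset.sum_eq_single 0]
    · simp only [hd, smul_eq_mul]
      simp
      ring
    · intro k hk hk0
      rw [hd, hz k (Nat.one_le_iff_ne_zero.2 hk0) (Finset.mem_range.1 hk), smul_zero]
    · intro h0
      exact absurd (Finset.mem_range.2 (by omega)) h0
  have hsmall := (hT.def (c := |D| / (t.factorial : ℝ) / 2) (by positivity)).filter_mono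
    (nhdsWithin_le_nhds (s := Set.Iio ξ))
  filter_upwards [hsmall, self_mem_nhdsWithin] with x hx hxξ
  have hxξ : x < ξ := hxξ
  rw [hev, Real.norm_eq_abs, Real.norm_eq_abs] at hx
  have hy : 0 < (ξ - x) ^ t := pow_pos (sub_pos.2 hxξ) t
  have habs : |(x - ξ) ^ t| = (ξ - x) ^ t := by
    rw [abs_pow, abs_sub_comm, abs_of_pos (sub_pos.2 hxξ)]
  have hsign : D * (x - ξ) ^ t = -(|D| * (ξ - x) ^ t) := by
    obtain ⟨k, rfl⟩ : ∃ k, t = k + 1 := ⟨t - 1, by omega⟩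
    simp only [Nat.add_sub_cancel] at hpos
    have e : (x - ξ) ^ (k + 1) = (-1) ^ (k + 1) * (ξ - x) ^ (k + 1) := by
      rw [← mul_pow]; congr 1; ring
    have e2 : |D| = (-1) ^ k * D := by
      rw [← abs_of_pos hpos, abs_mul, abs_pow, abs_neg, abs_one, one_pow, one_mul]
    rw [e, e2]
    ring
  rw [habs] at hx
  have h2 : L x - (L ξ + D / (t.factorial : ℝ) * (x - ξ) ^ t) ≤
      |D| / (t.factorial : ℝ) / 2 * (ξ - x) ^ t := (le_abs_self _).trans hx
  have h3 : D / (t.factorial : ℝ) * (x - ξ) ^ t = -(|D| / (t.factorial : ℝ) * (ξ - x) ^ t) := by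
    rw [div_mul_eq_mul_div, hsign]
    ring
  have h4 : 0 < |D| / (t.factorial : ℝ) * (ξ - x) ^ t := by positivity
  linarith

/-- A loss that is at most `A` beyond `ξ` and increases at `ξ` is strictly below `A` on some
interval, and at most `A` beyond it. -/
lemma exists_gap {L : ℝ → ℝ} (hL : ∀ x : ℝ, 0 < x → 0 ≤ L x) {ξ : ℝ} (hξ : 0 < ξ)
    (hinc : UpwardJumpAt L ξ ∨ SmoothIncreaseAt L ξ) {A : ℝ} (hA : ∀ x, ξ < x → L x ≤ A) :
    ∃ α β A' : ℝ, 0 < α ∧ α < β ∧ 0 ≤ A' ∧ A' < A ∧ (∀ x ∈ Set.Ioo α β, L x ≤ A') ∧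
      ∀ x, α < x → x ≠ ξ → L x ≤ A := by
  rcases hinc with ⟨l₁, l₂, h₁, h₂, hlt⟩ | hs
  · have hl₂ : l₂ ≤ A := le_of_tendsto h₂ (by
      filter_upwards [self_mem_nhdsWithin] with x hx using hA x hx)
    have hev : ∀ᶠ x in 𝓝[<] ξ, L x < (l₁ + l₂) / 2 := h₁.eventually_lt_const (by linarith)
    obtain ⟨α, hα, hsub⟩ := (mem_nhdsLT_iff_exists_mem_Ico_Ioo_subset hξ).1 hev
    -- `α` may be 0; moving to the midpoint makes the left end positive.
    set α' := (α + ξ) / 2 with hα'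
    have h1 : α < α' := by rw [hα']; linarith [hα.2]
    have h2 : α' < ξ := by rw [hα']; linarith [hα.2]
    have h0 : 0 < α' := lt_of_le_of_lt hα.1 h1
    have hlow : ∀ x ∈ Set.Ioo α' ξ, L x ≤ (l₁ + l₂) / 2 := fun x hx =>
      (hsub ⟨h1.trans hx.1, hx.2⟩ : L x < _).le
    refine ⟨α', ξ, (l₁ + l₂) / 2, h0, h2, ?_, by linarith, hlow, fun x hx hne => ?_⟩
    · have hm : (α' + ξ) / 2 ∈ Set.Ioo α' ξ := ⟨by linarith, by linarith⟩
      exact (hL _ (h0.trans hm.1)).trans (hlow _ hm)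
    · rcases lt_or_gt_of_ne hne with h | h
      · linarith [hlow x ⟨hx, h⟩]
      · exact hA x h
  · have hev := hs.eventually_lt
    obtain ⟨t, ht, ⟨a, b, ha, hb, hc⟩, -, -⟩ := hs
    have hcont : ∀ x ∈ Set.Ioo a b, ContinuousAt L x := fun x hx =>
      hc.continuousOn.continuousAt (Ioo_mem_nhds hx.1 hx.2)
    have hLξ : L ξ ≤ A := by
      refine le_of_tendsto ((hcont ξ ⟨ha, hb⟩).tendsto.mono_left
        (nhdsWithin_le_nhds (s := Set.Ioi ξ))) ?_
      filter_upwards [self_mem_nhdsWithin] with x hx using hA x hx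
    obtain ⟨α, hα, hsub⟩ := (mem_nhdsLT_iff_exists_mem_Ico_Ioo_subset
      (max_lt hξ ha)).1 hev
    have h0α : 0 ≤ α := (le_max_left _ _).trans hα.1
    have haα : a ≤ α := (le_max_right _ _).trans hα.1
    have hαξ : α < ξ := hα.2
    -- Just left of `ξ` the loss is below `L ξ`, but by amounts that shrink to 0. A uniform gap is
    -- obtained by continuity on a short interval ending at `x₀ < ξ` instead.
    set x₀ := (α + ξ) / 2 with hx₀
    have h1 : α < x₀ := by rw [hx₀]; linarith
    have h2 : x₀ < ξ := by rw [hx₀]; linarith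
    have hlt : L x₀ < L ξ := hsub ⟨h1, h2⟩
    have hnear : ∀ᶠ x in 𝓝[<] x₀, L x < (L x₀ + L ξ) / 2 :=
      ((hcont x₀ ⟨haα.trans_lt h1, h2.trans hb⟩).tendsto.mono_left
        nhdsWithin_le_nhds).eventually_lt_const (by linarith)
    obtain ⟨α', hα'', hsub'⟩ := (mem_nhdsLT_iff_exists_mem_Ico_Ioo_subset h1).1 hnear
    set α₁ := (α' + x₀) / 2 with hα₁
    have h3 : α' < α₁ := by rw [hα₁]; linarith [hα''.2]
    have h4 : α₁ < x₀ := by rw [hα₁]; linarith [hα''.2]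
    have h5 : α < α₁ := hα''.1.trans_lt h3
    have h0 : 0 < α₁ := h0α.trans_lt h5
    have hx₀0 : 0 ≤ L x₀ := hL _ (h0.trans h4)
    refine ⟨α₁, x₀, (L x₀ + L ξ) / 2, h0, h4, by linarith, by linarith, fun x hx => ?_,
      fun x hx hne => ?_⟩
    · exact (hsub' ⟨h3.trans hx.1, hx.2⟩ : L x < _).le
    · rcases lt_or_gt_of_ne hne with h | h
      · exact (hsub ⟨h5.trans hx, h⟩ : L x < L ξ).le.trans hLξ
      · exact hA x h

/-- This handles the escape Ω → 0, where the average tends to at least A: no such sequence beats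
every positive Ω. -/
lemma exists_gammaAvg_le_limit_zero {r : ℕ} (hr : 1 ≤ r) {L : ℝ → ℝ}
    (hL : ∀ x : ℝ, 0 < x → 0 ≤ L x)
    (h4 : DecreasingNearZero r L) :
    ∃ A : ℝ≥0∞, Tendsto (lossExt L) (𝓝[>] 0) (𝓝 A) ∧
      ∃ Ω : ℝ, 0 < Ω ∧ gammaAvg r (lossExt L) Ω ≤ A := by
  obtain ⟨ξ, hξ, hanti, hpos⟩ := h4
  have hf : AntitoneOn (lossExt L) (Set.Ioc 0 ξ) := fun x hx y hy hxy => by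
    rw [lossExt_of_pos L hx.1, lossExt_of_pos L hy.1]
    exact ENNReal.ofReal_le_ofReal (hanti hx hy hxy)
  exact ⟨_, tendsto_nhdsGT_zero_of_antitoneOn hξ hf,
    exists_gammaAvg_le_of_integral_pos hr hL hξ hpos fun x hx =>
      le_sSup (Set.mem_image_of_mem _ hx)⟩

/-- The counterpart for Ω → ∞. If A is infinite any Ω serves; otherwise the increase at ξ' provides
a gap below A, and a large Ω makes the mass to its left negligible. -/
lemma exists_gammaAvg_le_limit_atTop {r : ℕ} (hr : 1 ≤ r) {L : ℝ → ℝ}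
    (hL : ∀ x : ℝ, 0 < x → 0 ≤ L x) (h1 : LocallyBV L) (h3 : PowerGrowth r L)
    (h4 : IncreasingNearInfinity L) :
    ∃ A : ℝ≥0∞, Tendsto (lossExt L) atTop (𝓝 A) ∧
      ∃ Ω : ℝ, 0 < Ω ∧ gammaAvg r (lossExt L) Ω ≤ A := by
  obtain ⟨ξ, hξ, hmono, hinc⟩ := h4
  have hf : MonotoneOn (lossExt L) (Set.Ioi ξ) := fun x hx y hy hxy => by
    rw [lossExt_of_pos L (hξ.trans hx), lossExt_of_pos L (hξ.trans hy)]
    exact ENNReal.ofReal_le_ofReal (hmono hx hy hxy)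
  refine ⟨_, tendsto_atTop_of_monotoneOn_Ioi hf, ?_⟩
  have hle : ∀ x, ξ < x → lossExt L x ≤ sSup (lossExt L '' Set.Ioi ξ) := fun x hx =>
    le_sSup (Set.mem_image_of_mem _ hx)
  generalize sSup (lossExt L '' Set.Ioi ξ) = A at hle
  by_cases hA : A = ⊤
  · exact ⟨1, one_pos, hA ▸ le_top⟩
  have hA' : ∀ x, ξ < x → L x ≤ A.toReal := fun x hx => by
    have := hle x hx
    rw [lossExt_of_pos L (hξ.trans hx)] at this
    exact (ENNReal.ofReal_le_iff_le_toReal hA).1 this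
  obtain ⟨α, β, A', hα, hαβ, h0, hlt, hmid, hbig⟩ := exists_gap hL hξ hinc hA'
  rw [← ENNReal.ofReal_toReal hA]
  refine exists_gammaAvg_le_of_gap hr (gammaAvg_one_lt_top hr h1 h3) hα hαβ h0 hlt
    (fun x hx => ?_) ?_
  · rw [lossExt_of_pos L (hα.trans hx.1)]
    exact ENNReal.ofReal_le_ofReal (hmid x hx)
  · have : ∀ᵐ x : ℝ, x ≠ ξ := by simp [ae_iff]
    filter_upwards [this] with x hne hx
    rw [lossExt_of_pos L (hα.trans hx)]
    exact ENNReal.ofReal_le_ofReal (hbig x hx hne)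

/-! ### Compactness in Ω -/

/-- Fatou's lemma: every ν > 0 eventually lies in the window [s k, S k], so the truncated integrands
converge pointwise to the full one. -/
lemma gammaAvg_limit_le_liminf {r : ℕ} (f : ℝ → ℝ≥0∞) (hf : Measurable f) (Ω : ℕ → ℝ)
    (s S : ℕ → ℝ) (hs : Tendsto s atTop (𝓝 0)) (hs0 : ∀ k, 0 < s k) (hS : Tendsto S atTop atTop)
    (g : ℝ → ℝ≥0∞)
    (hg : ∀ᵐ ν, 0 < ν → Tendsto (fun k => f (Ω k / ν)) atTop (𝓝 (g ν))) :
    ∫⁻ ν in Set.Ioi 0, gammaDens r ν * g ν ≤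
      liminf (fun k => truncAvg r f (s k) (S k) (Ω k)) atTop := by
  set F : ℕ → ℝ → ℝ≥0∞ := fun k =>
    (Set.Icc (s k) (S k)).indicator fun ν => gammaDens r ν * f (Ω k / ν) with hF
  have hm : ∀ k, Measurable (F k) := fun k =>
    Measurable.indicator ((measurable_gammaDens r).mul
      (hf.comp (by fun_prop : Measurable fun ν : ℝ => Ω k / ν))) measurableSet_Icc
  have hT : ∀ k, truncAvg r f (s k) (S k) (Ω k) = ∫⁻ ν in Set.Ioi 0, F k ν := by
    intro k
    rw [truncAvg, hF]
    simp only
    rw [lintegral_indicator measurableSet_Icc, Measure.restrict_restrict measurableSet_Icc,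
      Set.inter_eq_self_of_subset_left]
    exact fun x hx => (hs0 k).trans_le hx.1
  simp_rw [hT]
  refine le_trans ?_ (lintegral_liminf_le hm)
  refine setLIntegral_mono_ae' measurableSet_Ioi (hg.mono fun ν hν hpos => ?_)
  have hpos : 0 < ν := hpos
  have ht : Tendsto (fun k => F k ν) atTop (𝓝 (gammaDens r ν * g ν)) := by
    have h1 : Tendsto (fun k => gammaDens r ν * f (Ω k / ν)) atTop (𝓝 (gammaDens r ν * g ν)) :=
      ENNReal.Tendsto.const_mul (hν hpos) (Or.inr ENNReal.ofReal_ne_top)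
    refine h1.congr' ?_
    filter_upwards [hs.eventually_le_const hpos, hS.eventually_ge_atTop ν] with k h2 h3
    simp only [hF]
    have hmem : ν ∈ Set.Icc (s k) (S k) := ⟨h2, h3⟩
    rw [Set.indicator_of_mem hmem]
  rw [ht.liminf_eq]

/-- A subsequence of Ω converges in [0, ∞]. A positive finite limit is itself the required point; a
limit 0 or ∞ gives A ≤ c₀, and then the point supplied by `h0` or `htop` works. -/
lemma exists_gammaAvg_le_of_truncAvg_le {r : ℕ} (hr : 1 ≤ r) {f : ℝ → ℝ≥0∞} (hf : Measurable f)
    (hd : {x : ℝ | 0 < x ∧ ¬ ContinuousAt f x}.Countable)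
    (h0 : ∃ A : ℝ≥0∞, Tendsto f (𝓝[>] 0) (𝓝 A) ∧ ∃ Ω : ℝ, 0 < Ω ∧ gammaAvg r f Ω ≤ A)
    (htop : ∃ A : ℝ≥0∞, Tendsto f atTop (𝓝 A) ∧ ∃ Ω : ℝ, 0 < Ω ∧ gammaAvg r f Ω ≤ A)
    {Ω s S : ℕ → ℝ} (hΩ : ∀ k, 0 < Ω k)
    (hs : Tendsto s atTop (𝓝 0)) (hs0 : ∀ k, 0 < s k) (hS : Tendsto S atTop atTop)
    {c : ℕ → ℝ≥0∞} {c₀ : ℝ≥0∞} (hc : Tendsto c atTop (𝓝 c₀))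
    (hle : ∀ k, truncAvg r f (s k) (S k) (Ω k) ≤ c k) :
    ∃ Ω₀ : ℝ, 0 < Ω₀ ∧ gammaAvg r f Ω₀ ≤ c₀ := by
  obtain ⟨ω, φ, hφ, hω⟩ := CompactSpace.tendsto_subseq fun k => ENNReal.ofReal (Ω k)
  have hφt := hφ.tendsto_atTop
  have key : ∀ g : ℝ → ℝ≥0∞,
      (∀ᵐ ν, 0 < ν → Tendsto (fun k => f (Ω (φ k) / ν)) atTop (𝓝 (g ν))) →
      ∫⁻ ν in Set.Ioi 0, gammaDens r ν * g ν ≤ c₀ := by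
    intro g hg
    refine (gammaAvg_limit_le_liminf f hf (fun k => Ω (φ k)) (fun k => s (φ k))
      (fun k => S (φ k)) (hs.comp hφt) (fun k => hs0 _) (hS.comp hφt) g hg).trans ?_
    rw [← (hc.comp hφt).liminf_eq]
    exact liminf_le_liminf (Eventually.of_forall fun k => hle (φ k))
  have hconst : ∀ A : ℝ≥0∞, ∫⁻ ν in Set.Ioi 0, gammaDens r ν * A = A := by
    intro A
    rw [lintegral_mul_const _ (measurable_gammaDens r), lintegral_gammaDens hr, one_mul]
  by_cases htp : ω = ⊤
  · obtain ⟨A, hA, Ω₀, hΩ₀, hA'⟩ := htop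
    refine ⟨Ω₀, hΩ₀, hA'.trans ?_⟩
    rw [← hconst A]
    refine key _ (ae_of_all _ fun ν hν => hA.comp ?_)
    have : Tendsto (fun k => Ω (φ k)) atTop atTop := by
      rw [htp] at hω
      exact ENNReal.tendsto_ofReal_nhds_top.1 hω
    exact this.atTop_div_const hν
  have hreal : Tendsto (fun k => Ω (φ k)) atTop (𝓝 ω.toReal) := by
    have := (ENNReal.tendsto_toReal htp).comp hω
    refine this.congr fun k => ?_
    simp [ENNReal.toReal_ofReal (hΩ (φ k)).le]
  rcases (ENNReal.toReal_nonneg (a := ω)).eq_or_lt with hz | hp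
  · obtain ⟨A, hA, Ω₀, hΩ₀, hA'⟩ := h0
    refine ⟨Ω₀, hΩ₀, hA'.trans ?_⟩
    rw [← hconst A]
    refine key _ (ae_of_all _ fun ν hν => hA.comp ?_)
    rw [← hz] at hreal
    refine tendsto_nhdsWithin_iff.2 ⟨?_, Eventually.of_forall fun k => div_pos (hΩ _) hν⟩
    simpa using hreal.div_const ν
  · refine ⟨ω.toReal, hp, key _ ?_⟩
    -- Convergence can fail only where ω/ν is a discontinuity of `f`, which happens for countably
    -- many ν.
    have hnull : ∀ᵐ ν : ℝ, ν ∉ (fun x => ω.toReal / x) '' {x : ℝ | 0 < x ∧ ¬ ContinuousAt f x} :=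
      measure_eq_zero_iff_ae_notMem.1 ((hd.image _).measure_zero _)
    filter_upwards [hnull] with ν hν hν0
    have hcont : ContinuousAt f (ω.toReal / ν) := by
      by_contra hcon
      exact hν ⟨ω.toReal / ν, ⟨div_pos hp hν0, hcon⟩, by field_simp⟩
    exact hcont.tendsto.comp (hreal.div_const ν)

lemma truncAvg_le_gammaAvg (r : ℕ) (f : ℝ → ℝ≥0∞) {s : ℝ} (hs : 0 < s) (S Ω : ℝ) :
    truncAvg r f s S Ω ≤ gammaAvg r f Ω :=
  lintegral_mono_set fun _ hx => hs.trans_le hx.1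

/-! ### Comparison of the law of N with the Gamma density -/

/-- From 1 + u ≤ e^u with u = ν/(n - ν) one gets (1 - ν/n)^n ≥ exp(-nν/(n - ν)) = exp(-ν) exp(-ν²/(n
- ν)), and the last factor is at least 1 - S²/(n - S). -/
lemma exp_neg_mul_le_one_sub_div_pow {n : ℕ} {S ν : ℝ} (hν : 0 ≤ ν) (hνS : ν ≤ S) (hn : S < n) :
    Real.exp (-ν) * (1 - S ^ 2 / (n - S)) ≤ (1 - ν / n) ^ n := by
  have hn0 : (0 : ℝ) < n := lt_of_le_of_lt (hν.trans hνS) hn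
  have hnν : ν < n := hνS.trans_lt hn
  have hx : 0 < 1 - ν / n := by
    rw [sub_pos, div_lt_one hn0]; exact hnν
  have h1 : Real.exp (-(ν / (n - ν))) ≤ 1 - ν / n := by
    have h := Real.add_one_le_exp (ν / (n - ν))
    have e : ν / (n - ν) + 1 = (1 - ν / n)⁻¹ := by
      have : (n : ℝ) - ν ≠ 0 := (sub_pos.2 hnν).ne'
      field_simp
      ring
    rw [e] at h
    rw [Real.exp_neg]
    exact inv_le_of_inv_le₀ hx h
  calc Real.exp (-ν) * (1 - S ^ 2 / (n - S))
      ≤ Real.exp (-ν) * Real.exp (-(ν ^ 2 / (n - ν))) := by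
        gcongr
        refine le_trans ?_ (Real.one_sub_le_exp_neg _)
        have : ν ^ 2 / (n - ν) ≤ S ^ 2 / (n - S) := by
          have := sub_pos.2 hn
          gcongr
        linarith
    _ = Real.exp (-(ν / (n - ν))) ^ n := by
        rw [← Real.exp_add, ← Real.exp_nat_mul]
        congr 1
        have : (n : ℝ) - ν ≠ 0 := (sub_pos.2 hnν).ne'
        field_simp
        ring
    _ ≤ _ := by gcongr

/-- A bound uniform in ν ∈ (0, S]: the falling factorial is at least (n - r + 1)^(r-1), and the
exponent n - r in place of n only increases the power. The remaining loss factor depends on n and S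
alone and tends to 1 > θ. -/
lemma eventually_phi_le_trialsProb {r : ℕ} (hr : 1 ≤ r) {S θ : ℝ} (hθ : θ < 1) :
    ∀ᶠ n : ℕ in atTop, ∀ ν : ℝ, 0 < ν → ν ≤ S →
      θ / n * phi r ν ≤ 1 / ν * trialsProb r (ν / n) n := by
  have hlim : Tendsto (fun n : ℕ => (1 - ((r - 1 : ℕ) : ℝ) / n) ^ (r - 1) *
      (1 - S ^ 2 / ((n : ℝ) - S))) atTop (𝓝 1) := by
    have h1 : Tendsto (fun n : ℕ => ((r - 1 : ℕ) : ℝ) / n) atTop (𝓝 0) :=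
      tendsto_const_div_atTop_nhds_zero_nat _
    have h2 : Tendsto (fun n : ℕ => S ^ 2 / ((n : ℝ) - S)) atTop (𝓝 0) :=
      tendsto_const_nhds.div_atTop
        (tendsto_atTop_add_const_right _ (-S) tendsto_natCast_atTop_atTop)
    have h := ((h1.const_sub 1).pow (r - 1)).mul (h2.const_sub 1)
    rwa [sub_zero, one_pow, one_mul] at h
  filter_upwards [hlim.eventually_const_le hθ, eventually_ge_atTop r,
    tendsto_natCast_atTop_atTop.eventually_gt_atTop S] with n hn hnr hnS ν hν hνS
  obtain ⟨k, rfl⟩ : ∃ k, r = k + 1 := ⟨r - 1, by omega⟩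
  simp only [Nat.add_sub_cancel] at hn
  have hn0 : (0 : ℝ) < n := (hν.trans_le hνS).trans hnS
  have hf : (0 : ℝ) < (k.factorial : ℝ) := by positivity
  have hx0 : 0 ≤ 1 - ν / n := by
    rw [sub_nonneg, div_le_one hn0]; exact (hνS.trans_lt hnS).le
  have hx1 : 1 - ν / n ≤ 1 := by
    have : 0 < ν / n := by positivity
    linarith
  have hdesc : (n : ℝ) ^ k * (1 - (k : ℝ) / n) ^ k ≤ ((n - 1).descFactorial k : ℝ) := by
    have h := Nat.pow_sub_le_descFactorial (n - 1) k
    have e : n - 1 + 1 - k = n - k := by omega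
    rw [e] at h
    have h' : (((n - k : ℕ) : ℝ)) ^ k ≤ ((n - 1).descFactorial k : ℝ) := by exact_mod_cast h
    rw [Nat.cast_sub (by omega)] at h'
    rw [← mul_pow]
    convert h' using 2
    field_simp
  have hpow : Real.exp (-ν) * (1 - S ^ 2 / (n - S)) ≤ (1 - ν / n) ^ (n - (k + 1)) :=
    (exp_neg_mul_le_one_sub_div_pow hν.le hνS hnS).trans
      (pow_le_pow_of_le_one hx0 hx1 (Nat.sub_le _ _))
  have hk0 : 0 ≤ 1 - (k : ℝ) / n := by
    rw [sub_nonneg, div_le_one hn0]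
    exact_mod_cast (by omega : k ≤ n)
  calc θ / n * phi (k + 1) ν
      ≤ ((1 - (k : ℝ) / n) ^ k * (1 - S ^ 2 / (n - S))) / n * phi (k + 1) ν := by
        have := (phi_pos (k + 1) hν).le
        gcongr
    _ = ((1 - (k : ℝ) / n) ^ k * (ν ^ k / (n * k.factorial))) *
          (Real.exp (-ν) * (1 - S ^ 2 / (n - S))) := by
        simp only [phi, Nat.add_sub_cancel]
        field_simp
    _ ≤ ((1 - (k : ℝ) / n) ^ k * (ν ^ k / (n * k.factorial))) * (1 - ν / n) ^ (n - (k + 1)) :=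
        mul_le_mul_of_nonneg_left hpow (by positivity)
    _ = ((n : ℝ) ^ k * (1 - (k : ℝ) / n) ^ k) *
          (ν ^ k / (n ^ (k + 1) * k.factorial) * (1 - ν / n) ^ (n - (k + 1))) := by
        field_simp
        ring
    _ ≤ ((n - 1).descFactorial k : ℝ) *
          (ν ^ k / (n ^ (k + 1) * k.factorial) * (1 - ν / n) ^ (n - (k + 1))) := by
        gcongr
    _ = 1 / ν * trialsProb (k + 1) (ν / n) n := by
        simp only [trialsProb, Nat.add_sub_cancel, div_pow]
        field_simp
        ring

/-! ### Averaging the risk against dp/p -/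

/-- The substitution p = ν/n carries [s, S] into [a, b] and turns y/p into (ny)/ν, so the estimate
enters only through Ω = ny. -/
lemma truncAvg_le_lintegral_trialsProb {r n : ℕ} {s S θ : ℝ} (hs : 0 < s) (hn : 0 < n)
    (hθ : 0 ≤ θ)
    (hden : ∀ ν : ℝ, 0 < ν → ν ≤ S → θ / n * phi r ν ≤ 1 / ν * trialsProb r (ν / n) n)
    (f : ℝ → ℝ≥0∞) {a b : ℝ} (ha : a ≤ s / n) (hb : S / n ≤ b) (y : ℝ) :
    ENNReal.ofReal (θ / n) * truncAvg r f s S (n * y) ≤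
      ∫⁻ p in Set.Icc a b, ENNReal.ofReal (1 / p) *
        (ENNReal.ofReal (trialsProb r p n) * f (y / p)) := by
  have hn0 : (0 : ℝ) < n := by exact_mod_cast hn
  have himg : (fun ν : ℝ => ν / n) '' Set.Icc s S ⊆ Set.Icc a b := by
    rintro _ ⟨ν, hν, rfl⟩
    exact ⟨ha.trans (div_le_div_of_nonneg_right hν.1 hn0.le),
      (div_le_div_of_nonneg_right hν.2 hn0.le).trans hb⟩
  have hinj : Set.InjOn (fun ν : ℝ => ν / n) (Set.Icc s S) := fun x _ y _ hxy => by
    simp only at hxy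
    field_simp at hxy
    exact hxy
  have hder : ∀ ν ∈ Set.Icc s S,
      HasDerivWithinAt (fun ν : ℝ => ν / n) (1 / n) (Set.Icc s S) ν := fun ν _ =>
    ((hasDerivAt_id ν).div_const (n : ℝ)).hasDerivWithinAt
  refine le_trans ?_ (lintegral_mono_set himg)
  rw [lintegral_image_eq_lintegral_abs_deriv_mul measurableSet_Icc hder hinj, truncAvg,
    ← lintegral_const_mul' _ _ ENNReal.ofReal_ne_top]
  refine setLIntegral_mono_ae' measurableSet_Icc (ae_of_all _ fun ν hν => ?_)
  have hν0 : 0 < ν := hs.trans_le hν.1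
  have e : y / (ν / n) = n * y / ν := by field_simp
  rw [e, gammaDens, ← mul_assoc, ← mul_assoc, ← mul_assoc,
    ← ENNReal.ofReal_mul (by positivity), ← ENNReal.ofReal_mul (by positivity),
    ← ENNReal.ofReal_mul (by positivity)]
  refine mul_le_mul_left (ENNReal.ofReal_le_ofReal ?_) _
  refine (hden ν hν0 hν.2).trans (le_of_eq ?_)
  rw [abs_of_pos (by positivity)]
  field_simp

lemma risk_eq_tsum_lossExt (r : ℕ) (L : ℝ → ℝ) (G : Estimator r) {p : ℝ} (hp : 0 < p) :
    risk r L G p = ∑' n : Set.Ici r, ENNReal.ofReal (trialsProb r p n) *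
      ∫⁻ y, lossExt L ((y : ℝ) / p) ∂(G n : Measure (Set.Ioi (0 : ℝ))) := by
  refine tsum_congr fun n => ?_
  congr 1
  exact lintegral_congr fun y => (lossExt_of_pos L (div_pos y.2 hp)).symm

lemma measurable_trialsProb (r n : ℕ) : Measurable fun p => trialsProb r p n := by
  unfold trialsProb; fun_prop

/-- Averaging one term of the risk against `dp / p` over `[a, b]`. -/
lemma le_lintegral_term {r n : ℕ} {s S θ : ℝ} (hs : 0 < s) (hn : 0 < n) (hθ : 0 ≤ θ)
    (hden : ∀ ν : ℝ, 0 < ν → ν ≤ S → θ / n * phi r ν ≤ 1 / ν * trialsProb r (ν / n) n)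
    {f : ℝ → ℝ≥0∞} (hf : Measurable f) {a b : ℝ} (ha : a ≤ s / n) (hb : S / n ≤ b) {c : ℝ≥0∞}
    (hc : ∀ Ω : ℝ, 0 < Ω → c ≤ truncAvg r f s S Ω)
    (μ : Measure (Set.Ioi (0 : ℝ))) [IsProbabilityMeasure μ] :
    ENNReal.ofReal (θ / n) * c ≤
      ∫⁻ p in Set.Icc a b, ENNReal.ofReal (1 / p) *
        (ENNReal.ofReal (trialsProb r p n) * ∫⁻ y, f ((y : ℝ) / p) ∂μ) := by
  have hn0 : (0 : ℝ) < n := by exact_mod_cast hn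
  have hT := measurable_trialsProb r n
  calc ENNReal.ofReal (θ / n) * c
      = ∫⁻ _y : Set.Ioi (0 : ℝ), ENNReal.ofReal (θ / n) * c ∂μ := by simp
    _ ≤ ∫⁻ y : Set.Ioi (0 : ℝ), (∫⁻ p in Set.Icc a b, ENNReal.ofReal (1 / p) *
          (ENNReal.ofReal (trialsProb r p n) * f ((y : ℝ) / p))) ∂μ := by
        refine lintegral_mono fun y => le_trans ?_
          (truncAvg_le_lintegral_trialsProb hs hn hθ hden f ha hb y)
        gcongr
        exact hc _ (mul_pos hn0 y.2)
    _ = ∫⁻ p in Set.Icc a b, (∫⁻ y : Set.Ioi (0 : ℝ), ENNReal.ofReal (1 / p) *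
          (ENNReal.ofReal (trialsProb r p n) * f ((y : ℝ) / p)) ∂μ) := by
        apply lintegral_lintegral_swap
        apply Measurable.aemeasurable
        have h1 : Measurable fun z : Set.Ioi (0 : ℝ) × ℝ => f ((z.1 : ℝ) / z.2) :=
          hf.comp (by fun_prop)
        have h2 : Measurable fun z : Set.Ioi (0 : ℝ) × ℝ => ENNReal.ofReal (trialsProb r z.2 n) :=
          (hT.comp measurable_snd).ennreal_ofReal
        have h3 : Measurable fun z : Set.Ioi (0 : ℝ) × ℝ => ENNReal.ofReal (1 / z.2) := by
          fun_prop
        exact h3.mul (h2.mul h1)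
    _ = _ := by
        refine lintegral_congr fun p => ?_
        rw [lintegral_const_mul' _ _ ENNReal.ofReal_ne_top,
          lintegral_const_mul' _ _ ENNReal.ofReal_ne_top]

lemma log_le_sum_inv_add (m M : ℕ) :
    Real.log M ≤ (∑ n ∈ Finset.Ico m (M + 1), (1 / n : ℝ)) + ∑ n ∈ Finset.range m, (1 / n : ℝ) := by
  have h := log_add_one_le_harmonic M
  rcases Nat.eq_zero_or_pos M with rfl | hM
  · simp only [Nat.cast_zero, Real.log_zero]
    positivity
  have h1 : Real.log M ≤ Real.log ((M + 1 : ℕ) : ℝ) := by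
    apply Real.log_le_log
    · exact_mod_cast hM
    · exact_mod_cast Nat.le_succ M
  refine (h1.trans h).trans ?_
  -- The added term n = 0 is harmless, since 1/0 = 0.
  have e : ((harmonic M : ℚ) : ℝ) = ∑ n ∈ Finset.range (M + 1), (1 / n : ℝ) := by
    rw [Finset.sum_range_succ', harmonic]
    push_cast
    simp
  rw [e, ← Finset.sum_union (by
    rw [Finset.disjoint_left]
    intro x hx hx'
    rw [Finset.mem_Ico] at hx
    rw [Finset.mem_range] at hx'
    omega)]
  refine Finset.sum_le_sum_of_subset_of_nonneg (fun x hx => ?_) fun x _ _ => by positivity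
  rw [Finset.mem_range] at hx
  rw [Finset.mem_union, Finset.mem_Ico, Finset.mem_range]
  omega

/-- The integral of the risk against dp/p over [s/M, b] is bounded above by the assumed risk bound
and below by the terms m ≤ n ≤ M. The left end s/M and S/m ≤ b are what place every window [s/n,
S/n] with such n inside the interval. -/
lemma sum_mul_le_mul_log {r : ℕ} (hr : 1 ≤ r) {L : ℝ → ℝ} (h2 : FinitelyManyDiscontinuities L)
    {s S θ : ℝ} (hs : 0 < s) (hsS : s ≤ S) (hθ : 0 ≤ θ) {c η₀ b : ℝ} (hc0 : 0 ≤ c) (hη : 0 ≤ η₀)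
    (hc : ∀ Ω : ℝ, 0 < Ω → ENNReal.ofReal c ≤ truncAvg r (lossExt L) s S Ω) (hb : 0 < b)
    (G : Estimator r) (hG : ∀ p : ℝ, 0 < p → p ≤ b → risk r L G p ≤ ENNReal.ofReal η₀)
    {m M : ℕ} (hrm : r ≤ m) (hmM : m ≤ M) (hm : S / m ≤ b)
    (hden : ∀ n : ℕ, m ≤ n → ∀ ν : ℝ, 0 < ν → ν ≤ S →
      θ / n * phi r ν ≤ 1 / ν * trialsProb r (ν / n) n) :
    θ * c * ∑ n ∈ Finset.Ico m (M + 1), (1 / n : ℝ) ≤ η₀ * Real.log (b / (s / M)) := by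
  have hm0 : (0 : ℝ) < m := by exact_mod_cast (by omega : 0 < m)
  have hM0 : (0 : ℝ) < M := by exact_mod_cast (by omega : 0 < M)
  have hmM' : (m : ℝ) ≤ M := by exact_mod_cast hmM
  set a := s / M with ha
  have ha0 : 0 < a := by positivity
  have hab : a ≤ b := by
    refine le_trans ?_ hm
    rw [ha]
    gcongr
    exact hs.le.trans hsS
  have hf := measurable_lossExt h2
  have hupper : ∫⁻ p in Set.Icc a b, ENNReal.ofReal (1 / p) * risk r L G p ≤
      ENNReal.ofReal (η₀ * Real.log (b / a)) := by
    calc ∫⁻ p in Set.Icc a b, ENNReal.ofReal (1 / p) * risk r L G p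
        ≤ ∫⁻ p in Set.Icc a b, ENNReal.ofReal (1 / p) * ENNReal.ofReal η₀ := by
          refine setLIntegral_mono_ae' measurableSet_Icc (ae_of_all _ fun p hp => ?_)
          gcongr
          exact hG p (ha0.trans_le hp.1) hp.2
      _ = (∫⁻ p in Set.Icc a b, ENNReal.ofReal (1 / p)) * ENNReal.ofReal η₀ :=
          lintegral_mul_const' _ _ ENNReal.ofReal_ne_top
      _ = ENNReal.ofReal (Real.log (b / a)) * ENNReal.ofReal η₀ := by
          congr 1
          have hi : IntegrableOn (fun p : ℝ => 1 / p) (Set.Icc a b) := by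
            apply ContinuousOn.integrableOn_Icc
            intro p hp
            have : p ≠ 0 := (ha0.trans_le hp.1).ne'
            exact ContinuousAt.continuousWithinAt (by fun_prop (disch := assumption))
          rw [← ofReal_integral_eq_lintegral_ofReal hi
            ((ae_restrict_mem measurableSet_Icc).mono fun p hp =>
              (one_div_pos.2 (ha0.trans_le hp.1)).le),
            integral_Icc_eq_integral_Ioc, ← intervalIntegral.integral_of_le hab,
            integral_one_div_of_pos ha0 hb]
      _ = _ := by rw [mul_comm, ENNReal.ofReal_mul hη]
  have hlower : ENNReal.ofReal (θ * c * ∑ n ∈ Finset.Ico m (M + 1), (1 / n : ℝ)) ≤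
      ∫⁻ p in Set.Icc a b, ENNReal.ofReal (1 / p) * risk r L G p := by
    set g : Set.Ici r → ℝ → ℝ≥0∞ := fun n p => ENNReal.ofReal (1 / p) *
      (ENNReal.ofReal (trialsProb r p n) *
        ∫⁻ y, lossExt L ((y : ℝ) / p) ∂(G n : Measure (Set.Ioi (0 : ℝ)))) with hg
    have hgm : ∀ n, Measurable (g n) := by
      intro n
      have h1 : Measurable fun z : ℝ × Set.Ioi (0 : ℝ) => lossExt L ((z.2 : ℝ) / z.1) :=
        hf.comp (by fun_prop)
      have h3 : Measurable fun p : ℝ => ENNReal.ofReal (1 / p) := by fun_prop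
      exact h3.mul ((measurable_trialsProb r n).ennreal_ofReal.mul h1.lintegral_prod_right)
    have hrisk : ∫⁻ p in Set.Icc a b, ENNReal.ofReal (1 / p) * risk r L G p =
        ∑' n : Set.Ici r, ∫⁻ p in Set.Icc a b, g n p := by
      rw [← lintegral_tsum fun n => (hgm n).aemeasurable]
      refine setLIntegral_congr_fun measurableSet_Icc fun p hp => ?_
      simp only [hg]
      rw [risk_eq_tsum_lossExt r L G (ha0.trans_le hp.1), ENNReal.tsum_mul_left]
    rw [hrisk]
    have hmem : ∀ n ∈ Finset.Ico m (M + 1), n ∈ Set.Ici r := fun n hn =>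
      hrm.trans (Finset.mem_Ico.1 hn).1
    have hterm : ∀ n : Set.Ici r, (n : ℕ) ∈ Finset.Ico m (M + 1) →
        ENNReal.ofReal (θ / (n : ℕ)) * ENNReal.ofReal c ≤ ∫⁻ p in Set.Icc a b, g n p := by
      intro n hn
      obtain ⟨h1, h2⟩ := Finset.mem_Ico.1 hn
      have h1' : (m : ℝ) ≤ (n : ℕ) := by exact_mod_cast h1
      have h2' : ((n : ℕ) : ℝ) ≤ M := by exact_mod_cast Nat.lt_succ_iff.1 h2
      have hn0 : (0 : ℝ) < (n : ℕ) := hm0.trans_le h1'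
      refine le_lintegral_term hs (by omega) hθ (hden n h1) hf ?_ ?_ hc _
      · rw [ha]
        gcongr
      · refine le_trans ?_ hm
        have := hs.le.trans hsS
        gcongr
    calc ENNReal.ofReal (θ * c * ∑ n ∈ Finset.Ico m (M + 1), (1 / n : ℝ))
        = ∑ n ∈ Finset.Ico m (M + 1), ENNReal.ofReal (θ / n) * ENNReal.ofReal c := by
          rw [Finset.mul_sum, ENNReal.ofReal_sum_of_nonneg fun n _ => by positivity]
          refine Finset.sum_congr rfl fun n _ => ?_
          rw [← ENNReal.ofReal_mul (by positivity)]
          congr 1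
          ring
      _ = ∑ n ∈ (Finset.Ico m (M + 1)).subtype (· ∈ Set.Ici r),
            ENNReal.ofReal (θ / (n : ℕ)) * ENNReal.ofReal c :=
          (Finset.sum_subtype_of_mem (fun n : ℕ => ENNReal.ofReal (θ / n) * ENNReal.ofReal c)
            hmem).symm
      _ ≤ ∑ n ∈ (Finset.Ico m (M + 1)).subtype (· ∈ Set.Ici r), ∫⁻ p in Set.Icc a b, g n p :=
          Finset.sum_le_sum fun n hn => hterm n (Finset.mem_subtype.1 hn)
      _ ≤ _ := ENNReal.sum_le_tsum _
  refine (ENNReal.ofReal_le_ofReal_iff ?_).1 (hlower.trans hupper)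
  exact mul_nonneg hη (Real.log_nonneg ((one_le_div ha0).2 hab))

/-- A uniform lower bound for `truncAvg` bounds from below every uniform bound for the risk
near `p = 0`. -/
lemma mul_le_of_risk_le {r : ℕ} (hr : 1 ≤ r) {L : ℝ → ℝ} (h2 : FinitelyManyDiscontinuities L)
    {s S θ : ℝ} (hs : 0 < s) (hsS : s ≤ S) (hθ : 0 ≤ θ) (hθ1 : θ < 1) {c η₀ b : ℝ} (hc0 : 0 ≤ c)
    (hη : 0 ≤ η₀)
    (hc : ∀ Ω : ℝ, 0 < Ω → ENNReal.ofReal c ≤ truncAvg r (lossExt L) s S Ω) (hb : 0 < b)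
    (G : Estimator r) (hG : ∀ p : ℝ, 0 < p → p ≤ b → risk r L G p ≤ ENNReal.ofReal η₀) :
    θ * c ≤ η₀ := by
  obtain ⟨m₀, hm₀⟩ := eventually_atTop.1 (eventually_phi_le_trialsProb hr (S := S) hθ1)
  have hSm : ∀ᶠ m : ℕ in atTop, S / m ≤ b :=
    (tendsto_const_div_atTop_nhds_zero_nat S).eventually_le_const hb
  obtain ⟨m, hmb, hmm₀, hrm⟩ :=
    (hSm.and ((eventually_ge_atTop m₀).and (eventually_ge_atTop r))).exists
  set C := ∑ n ∈ Finset.range m, (1 / n : ℝ)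
  by_contra! hcon
  -- As M grows with m fixed, the two sides of `sum_mul_le_mul_log` grow like θc log M and η₀ log M
  -- up to constants, so θc > η₀ is impossible.
  have hlog : Tendsto (fun M : ℕ => (θ * c - η₀) * Real.log M) atTop atTop :=
    (Real.tendsto_log_atTop.comp tendsto_natCast_atTop_atTop).const_mul_atTop (sub_pos.2 hcon)
  obtain ⟨M, hM, hmM⟩ := ((hlog.eventually_gt_atTop
    (η₀ * Real.log (b / s) + θ * c * C)).and (eventually_ge_atTop m)).exists
  have hM0 : (0 : ℝ) < M := by exact_mod_cast (by omega : 0 < M)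
  have key := sum_mul_le_mul_log hr h2 hs hsS hθ hc0 hη hc hb G hG hrm hmM hmb
    fun n hn => hm₀ n (hmm₀.trans hn)
  have h := mul_le_mul_of_nonneg_left (log_le_sum_inv_add m M) (mul_nonneg hθ hc0)
  have e : Real.log (b / (s / M)) = Real.log (b / s) + Real.log M := by
    rw [← Real.log_mul (by positivity) (by positivity)]
    congr 1
    field_simp
  rw [e] at key
  rw [mul_add] at h
  linarith

/-- `ENNReal.ofReal` sends negative reals to 0, so a negative bound has to be excluded before
passing to it. -/
lemma risk_le_ofReal_of_coe_le {x : ℝ≥0∞} {η : ℝ} (h : (x : EReal) ≤ (η : EReal)) :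
    0 ≤ η ∧ x ≤ ENNReal.ofReal η := by
  have h0 : 0 ≤ η := by
    have := (EReal.coe_ennreal_nonneg x).trans h
    exact_mod_cast this
  refine ⟨h0, ?_⟩
  rw [← EReal.coe_ennreal_le_coe_ennreal_iff, EReal.coe_ennreal_ofReal, max_eq_left h0]
  exact h

end InverseBinomial

/-! ### The minimum and the lower bound -/

theorem mainTheorem10 (r : ℕ) (hr : 1 ≤ r) (L : ℝ → ℝ)
    (hL : ∀ x : ℝ, 0 < x → 0 ≤ L x)
    (h1 : InverseBinomial.LocallyBV L)
    (h2 : InverseBinomial.FinitelyManyDiscontinuities L)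
    (h3 : InverseBinomial.PowerGrowth r L)
    (h4a : InverseBinomial.DecreasingNearZero r L)
    (h4b : InverseBinomial.IncreasingNearInfinity L) :
    ∃ ηstar : ℝ≥0,
      IsLeast (InverseBinomial.asymptoticRisk r L '' Set.Ioi 0) (ηstar : ℝ≥0∞) ∧
      ∀ η₀ : ℝ, η₀ < (ηstar : ℝ) → ∀ p₂ : ℝ, 0 < p₂ →
        ¬ ∃ G : InverseBinomial.Estimator r, ∀ p : ℝ, 0 < p → p < 1 → p < p₂ →
          ((InverseBinomial.risk r L G p : ℝ≥0∞) : EReal) ≤ ((η₀ : ℝ) : EReal) := by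
  open InverseBinomial in
  set f := lossExt L with hf
  have hfin := gammaAvg_one_lt_top hr h1 h3
  have hs : Tendsto (fun k : ℕ => 1 / ((k : ℝ) + 1)) atTop (𝓝 0) :=
    tendsto_one_div_add_atTop_nhds_zero_nat
  have hs0 : ∀ k : ℕ, 0 < 1 / ((k : ℝ) + 1) := fun k => by positivity
  have hS : Tendsto (fun k : ℕ => (k : ℝ) + 1) atTop atTop :=
    tendsto_atTop_add_const_right _ _ tendsto_natCast_atTop_atTop
  -- Used twice: with c a minimizing sequence of values, to get the minimum, and with c constant, to
  -- get a lower bound uniform in Ω.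
  have hcompact : ∀ {Ω : ℕ → ℝ} (_ : ∀ k, 0 < Ω k) {c : ℕ → ℝ≥0∞} {c₀ : ℝ≥0∞}
      (_ : Tendsto c atTop (𝓝 c₀))
      (_ : ∀ k : ℕ, truncAvg r f (1 / ((k : ℝ) + 1)) ((k : ℝ) + 1) (Ω k) ≤ c k),
      ∃ Ω₀ : ℝ, 0 < Ω₀ ∧ gammaAvg r f Ω₀ ≤ c₀ := fun hΩ _ _ hc hle =>
    exists_gammaAvg_le_of_truncAvg_le hr (measurable_lossExt h2)
      (countable_discontinuities_lossExt h2) (exists_gammaAvg_le_limit_zero hr hL h4a)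
      (exists_gammaAvg_le_limit_atTop hr hL h1 h3 h4b) hΩ hs hs0 hS hc hle
  obtain ⟨Ω₀, hΩ₀, hmin⟩ : ∃ Ω₀ : ℝ, 0 < Ω₀ ∧ ∀ Ω : ℝ, 0 < Ω → gammaAvg r f Ω₀ ≤ gammaAvg r f Ω := by
    have hne : (gammaAvg r f '' Set.Ioi 0).Nonempty := Set.Nonempty.image _ ⟨1, Set.mem_Ioi.2 one_pos⟩
    obtain ⟨u, -, hu, humem⟩ := exists_seq_tendsto_sInf hne (OrderBot.bddBelow _)
    choose Ω hΩ hΩu using humem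
    obtain ⟨Ω₀, hΩ₀, hle⟩ := hcompact hΩ hu fun k =>
      (truncAvg_le_gammaAvg r f (hs0 k) _ _).trans (hΩu k).le
    exact ⟨Ω₀, hΩ₀, fun Ω hΩ => hle.trans (sInf_le (Set.mem_image_of_mem _ hΩ))⟩
  have hne : gammaAvg r f Ω₀ ≠ ⊤ := ((hmin 1 one_pos).trans_lt hfin).ne
  refine ⟨(gammaAvg r f Ω₀).toNNReal, ?_, ?_⟩
  · rw [ENNReal.coe_toNNReal hne]
    refine ⟨⟨Ω₀, hΩ₀, asymptoticRisk_eq_gammaAvg r L hΩ₀⟩, ?_⟩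
    rintro _ ⟨Ω, hΩ, rfl⟩
    rw [asymptoticRisk_eq_gammaAvg r L hΩ]
    exact hmin Ω hΩ
  · rintro η₀ hη₀ p₂ hp₂ ⟨G, hG⟩
    set η := (gammaAvg r f Ω₀).toReal with hη
    change η₀ < η at hη₀
    set b := min p₂ 1 / 2 with hb
    have hmpos : 0 < min p₂ 1 := lt_min hp₂ one_pos
    have hb0 : 0 < b := half_pos hmpos
    have hblt : b < min p₂ 1 := half_lt_self hmpos
    have hrisk : ∀ p : ℝ, 0 < p → p ≤ b → 0 ≤ η₀ ∧ risk r L G p ≤ ENNReal.ofReal η₀ :=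
      fun p hp hpb => risk_le_ofReal_of_coe_le
        (hG p hp (hpb.trans_lt (hblt.trans_le (min_le_right _ _)))
          (hpb.trans_lt (hblt.trans_le (min_le_left _ _))))
    have hη₀0 : 0 ≤ η₀ := (hrisk b hb0 le_rfl).1
    set c := (η₀ + η) / 2 with hc
    have hc1 : η₀ < c := by rw [hc]; linarith
    have hc2 : c < η := by rw [hc]; linarith
    have hc0 : 0 < c := hη₀0.trans_lt hc1
    -- If every window failed for some Ω, compactness would give a full average at most c < η*.
    obtain ⟨k, hk⟩ : ∃ k : ℕ, ∀ Ω : ℝ, 0 < Ω →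
        ENNReal.ofReal c ≤ truncAvg r f (1 / ((k : ℝ) + 1)) ((k : ℝ) + 1) Ω := by
      by_contra! hcon
      choose Ω hΩ hlt using hcon
      obtain ⟨Ω₁, hΩ₁, hle⟩ := hcompact hΩ tendsto_const_nhds fun k => (hlt k).le
      have h := (hmin Ω₁ hΩ₁).trans hle
      have h' := ENNReal.toReal_le_of_le_ofReal hc0.le h
      exact absurd h' (not_le.2 hc2)
    have hle : 1 / ((k : ℝ) + 1) ≤ (k : ℝ) + 1 := by
      have h0 : (0 : ℝ) ≤ k := k.cast_nonneg
      rw [div_le_iff₀ (by positivity)]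
      nlinarith
    have hfrac : η₀ / c < 1 := (div_lt_one hc0).2 hc1
    -- With θ midway between η₀/c and 1, θc = (η₀ + c)/2 still exceeds η₀.
    have key := mul_le_of_risk_le hr h2 (hs0 k) hle (θ := (η₀ / c + 1) / 2) (by positivity)
      (by linarith) hc0.le hη₀0 hk hb0 G fun p hp hpb => (hrisk p hp hpb).2
    have e : (η₀ / c + 1) / 2 * c = (η₀ + c) / 2 := by field_simp
    rw [e] at key
    linarith
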